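/- Let $k$ be a field and $S$ a finite poset. An $S$-space $\mathbf V=(V,V(s))_{s\in S}$ is a finite-dimensional $k$-vector space $V$ with subspaces $V(s)$ such that $V(s)\subseteq V(t)$ whenever $s\le t$; a morphism $\mathbf U\to\mathbf V$ is a $k$-linear map $f:U\to V$ with $f(U(s))\subseteq V(s)$ for all $s$. Let $S\text{-sp}$ be the category of $S$-spaces, with the obvious direct sums. $\mathbf V$ is full at $p\in S$ if $V(p)=V$. Let $\hat a(S)$ be the poset of nonempty antichains of $S$, where $A\le B$ if and only if for every $b\in B$ there is $a\in A$ with $a\le b$; identify $s\in S$ with $\{s\}$ and write $a\wedge b$ for $\{a,b\}$. The width $w(T)$ of a subset $T\subseteq S$ is the largest cardinality of an antichain in $T$. For $p\in S$ put $\langle p\rangle=\{s\in S: p\le s\}$ and $(p)=\{s\in S:s\le p\}$, let $S_{\langle p\rangle}=\langle p\rangle\cup\hat a(S\setminus\langle p\rangle)\subseteq\hat a(S)$, and let the derived poset be $S_p=\{t\in S_{\langle p\rangle}: t\not\le p\}$. For a subposet $R$ of a poset $P$, let $\mathrm{res}^P_R$ be the forgetful functor from $P$-spaces to $R$-spaces,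 and let $\mathrm{coind}^P_R$ send an $R$-space $\mathbf V$ to the $P$-space with ambient space $V$ and subspaces $\bigcap_{r\in R,\,x\le r}V(r)$, $x\in P$ (equal to $V$ if there is no such $r$), being the identity on underlying linear maps. For $q\in P$ let $E_q$ be the endofunctor of $P$-spaces sending $\mathbf V$ to $\bigl(V/V(q),(V(x)+V(q))/V(q)\bigr)_{x\in P}$, and a morphism to the induced map of quotients. Theorem. Let $p\in S$ satisfy $w(S\setminus\langle p\rangle)\le 2$, and let $D=\mathrm{res}^{S_{\langle p\rangle}}_{S_p}\,E_p\,\mathrm{coind}^{S_{\langle p\rangle}}_{S}:S\text{-sp}\to S_p\text{-sp}$. (a) Let $\mathfrak A$ be the full subcategory of $S\text{-sp}$ of the $S$-spaces with no nonzero direct summand full at $p$. The restriction of $D$ to $\mathfrak A$ is a representation equivalence $\mathfrak A\to S_p\text{-sp}$, i.e. it is dense, full and reflects isomorphisms. (b) Let $\mathfrak F$ be the two-sided ideal of $S\text{-sp}$ of the morphisms that factor through an $S$-space full at $p$, and let $S\text{-sp}/\mathfrak F$ be the quotient category (same objects, morphism spaces $\mathrm{Hom}(\mathbf U,\mathbf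 V)/\mathfrak F(\mathbf U,\mathbf V)$). Then $D$ induces an equivalence of categories $S\text{-sp}/\mathfrak F\to S_p\text{-sp}$. (c) Every element of $S_p$ is either some $s\in S\setminus(p)$ or $a\wedge b$ with $a\neq b$ in $S\setminus[\langle p\rangle\cup(p)]$ and $\{p,a,b\}$ an antichain. For each $S$-space $\mathbf V$ one has $D\mathbf V=(X,X(t))_{t\in S_p}$, where $X=V/V(p)$, $X(s)=(V(s)+V(p))/V(p)$ for $s\in S\setminus(p)$, and $X(a\wedge b)=(V(a)\cap V(b)+V(p))/V(p)$ for $a,b\in S\setminus[\langle p\rangle\cup(p)]$ with $\{p,a,b\}$ an antichain. If $f:\mathbf U\to\mathbf V$ is a morphism of $S$-spaces, then $Df$ is the $k$-linear map $U/U(p)\to V/V(p)$, $u+U(p)\mapsto f(u)+V(p)$. -/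

import Mathlib

open CategoryTheory

universe u v w

namespace PosetDiff

section Posets

variable {S : Type v} [PartialOrder S]

/-- The width of a subset `T` of a poset: the largest cardinality of an antichain contained
in `T`. -/
noncomputable def width (T : Set S) : ℕ∞ :=
  ⨆ A : {A : Set S // A ⊆ T ∧ IsAntichain (· ≤ ·) A}, A.1.encard

variable (S) in
/-- The set `â(S)` of nonempty antichains of `S`. -/
@[ext]
structure AHat where
  carrier : Set S
  nonempty : carrier.Nonempty
  antichain : IsAntichain (· ≤ ·) carrier

/-- `A ≤ B` in `â(S)` iff every element of `B` has an element of `A` below it. In this order a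
nonempty antichain is the meet of its elements. -/
instance : PartialOrder (AHat S) where
  le A B := ∀ b ∈ B.carrier, ∃ a ∈ A.carrier, a ≤ b
  le_refl A a ha := ⟨a, ha, le_rfl⟩
  le_trans A B C hAB hBC c hc := by
    obtain ⟨b, hb, hbc⟩ := hBC c hc
    obtain ⟨a, ha, hab⟩ := hAB b hb
    exact ⟨a, ha, hab.trans hbc⟩
  le_antisymm A B hAB hBA := by
    have key : ∀ X Y : AHat S, (∀ b ∈ Y.carrier, ∃ a ∈ X.carrier, a ≤ b) →
        (∀ b ∈ X.carrier, ∃ a ∈ Y.carrier, a ≤ b) → X.carrier ⊆ Y.carrier := by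
      intro X Y hXY hYX x hx
      obtain ⟨y, hy, hyx⟩ := hYX x hx
      obtain ⟨x', hx', hxy⟩ := hXY y hy
      have h1 : x' = x := X.antichain.eq hx' hx (hxy.trans hyx)
      subst h1
      exact le_antisymm hyx hxy ▸ hy
    exact AHat.ext (Set.Subset.antisymm (key A B hAB hBA) (key B A hBA hAB))

theorem AHat.le_def (A B : AHat S) :
    A ≤ B ↔ ∀ b ∈ B.carrier, ∃ a ∈ A.carrier, a ≤ b := Iff.rfl

/-- The element `s` of `S`, seen in `â(S)` as the antichain `{s}`. -/
def AHat.single (s : S) : AHat S := ⟨{s}, Set.singleton_nonempty s, Set.subsingleton_singleton.isAntichain _⟩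

/-- For a subset `R` of `S`, the subposet `S_R = R ∪ â(S ∖ R)` of `â(S)`. -/
abbrev Enl (R : Set S) : Type v :=
  {A : AHat S // (∃ r ∈ R, A = AHat.single r) ∨ A.carrier ⊆ Rᶜ}

/-- The inclusion of `S` into `S_R`, sending `s` to `{s}`. -/
def Enl.incl (R : Set S) : S ↪o Enl R where
  toFun s := ⟨AHat.single s, by
    by_cases h : s ∈ R
    · exact Or.inl ⟨s, h, rfl⟩
    · exact Or.inr (by simpa [AHat.single] using h)⟩
  inj' s t h := by
    have h2 : (AHat.single s).carrier = (AHat.single t).carrier :=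
      congrArg (fun A : Enl R => A.1.carrier) h
    exact Set.singleton_injective h2
  map_rel_iff' := by
    intro s t
    constructor
    · intro h
      obtain ⟨x, hx, hxt⟩ := h t rfl
      obtain rfl : x = s := hx
      exact hxt
    · rintro h x hx
      obtain rfl : x = t := hx
      exact ⟨s, rfl, h⟩

/-- The derived poset `S_p`: the poset `S_⟨p⟩`, where `⟨p⟩ = {s | p ≤ s}`, with the principal ideal
of `S_⟨p⟩` generated by `p` removed. -/
abbrev Derived (p : S) : Type v :=
  {t : Enl (Set.Ici p) // ¬ t ≤ Enl.incl (Set.Ici p) p}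

/-- An element `s` of `S` with `s ∉ (p)`, as an element of the derived poset. -/
def Derived.single {p : S} (s : S) (hs : ¬ s ≤ p) : Derived p :=
  ⟨Enl.incl _ s, fun h => hs ((Enl.incl _).le_iff_le.1 h)⟩

/-- The element `a ∧ b` of the derived poset, where `a, b` lie outside `⟨p⟩ ∪ (p)` and `{p, a, b}` is
an antichain. -/
def Derived.meet {p : S} (a b : S) (ha : a ∉ Set.Ici p ∪ Set.Iic p)
    (hb : b ∉ Set.Ici p ∪ Set.Iic p) (hab : IsAntichain (· ≤ ·) ({p, a, b} : Set S)) :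
    Derived p :=
  ⟨⟨⟨{a, b}, Set.insert_nonempty _ _, hab.subset (Set.subset_insert _ _)⟩, Or.inr (by
      rintro x (rfl | rfl)
      · exact fun h => ha (Or.inl h)
      · exact fun h => hb (Or.inl h))⟩, by
    intro h
    obtain ⟨x, hx, hxp⟩ := h p rfl
    rcases hx with rfl | rfl
    · exact ha (Or.inr hxp)
    · exact hb (Or.inr hxp)⟩

end Posets

/-- An `S`-space over the field `k`: a finite-dimensional ambient space `V` and a monotone family
of subspaces `V(s)`, `s ∈ S`. -/
structure SSpace (k : Type u) [Field k] (S : Type v) [PartialOrder S] where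
  carrier : Type u
  [addCommGroup : AddCommGroup carrier]
  [module : Module k carrier]
  [finiteDimensional : FiniteDimensional k carrier]
  sub : S → Submodule k carrier
  mono : Monotone sub

attribute [instance] SSpace.addCommGroup SSpace.module SSpace.finiteDimensional

namespace SSpace

variable {k : Type u} [Field k] {S : Type v} [PartialOrder S]

/-- A morphism `U → V` of `S`-spaces: a linear map `f` of ambient spaces with `f(U(s)) ⊆ V(s)`. -/
@[ext]
structure Hom (U V : SSpace k S) where
  lin : U.carrier →ₗ[k] V.carrier
  map_sub : ∀ s, (U.sub s).map lin ≤ V.sub s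

instance : Category (SSpace k S) where
  Hom := Hom
  id V := ⟨LinearMap.id, fun s => by simp⟩
  comp f g := ⟨g.lin ∘ₗ f.lin, fun s => by
    rw [Submodule.map_comp]
    exact (Submodule.map_mono (f.map_sub s)).trans (g.map_sub s)⟩

@[ext]
theorem hom_ext {U V : SSpace k S} {f g : U ⟶ V} (h : f.lin = g.lin) : f = g := Hom.ext h

@[simp] theorem id_lin (V : SSpace k S) : Hom.lin (𝟙 V) = LinearMap.id := rfl

@[simp] theorem comp_lin {U V W : SSpace k S} (f : U ⟶ V) (g : V ⟶ W) :
    (f ≫ g).lin = g.lin ∘ₗ f.lin := rfl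

section HomModule

variable {U V : SSpace k S}

theorem Hom.mem (f : U ⟶ V) {s : S} {x : U.carrier} (hx : x ∈ U.sub s) : f.lin x ∈ V.sub s :=
  f.map_sub s (Submodule.mem_map_of_mem hx)

instance : Zero (U ⟶ V) := ⟨⟨0, fun s => by simp⟩⟩

instance : Add (U ⟶ V) := ⟨fun f g => ⟨f.lin + g.lin, fun s => by
  rintro _ ⟨x, hx, rfl⟩
  exact add_mem (Hom.mem f hx) (Hom.mem g hx)⟩⟩

instance : Neg (U ⟶ V) := ⟨fun f => ⟨-f.lin, fun s => by
  rintro _ ⟨x, hx, rfl⟩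
  exact neg_mem (Hom.mem f hx)⟩⟩

instance : Sub (U ⟶ V) := ⟨fun f g => ⟨f.lin - g.lin, fun s => by
  rintro _ ⟨x, hx, rfl⟩
  exact sub_mem (Hom.mem f hx) (Hom.mem g hx)⟩⟩

instance : SMul k (U ⟶ V) := ⟨fun c f => ⟨c • f.lin, fun s => by
  rintro _ ⟨x, hx, rfl⟩
  exact Submodule.smul_mem _ c (Hom.mem f hx)⟩⟩

instance : SMul ℕ (U ⟶ V) := ⟨fun n f => ⟨n • f.lin, fun s => by
  rintro _ ⟨x, hx, rfl⟩
  exact nsmul_mem (Hom.mem f hx) n⟩⟩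

instance : SMul ℤ (U ⟶ V) := ⟨fun n f => ⟨n • f.lin, fun s => by
  rintro _ ⟨x, hx, rfl⟩
  exact zsmul_mem (Hom.mem f hx) n⟩⟩

@[simp] theorem zero_lin : (0 : U ⟶ V).lin = 0 := rfl
@[simp] theorem add_lin (f g : U ⟶ V) : (f + g).lin = f.lin + g.lin := rfl
@[simp] theorem neg_lin (f : U ⟶ V) : (-f).lin = -f.lin := rfl
@[simp] theorem sub_lin (f g : U ⟶ V) : (f - g).lin = f.lin - g.lin := rfl
@[simp] theorem smul_lin (c : k) (f : U ⟶ V) : (c • f).lin = c • f.lin := rfl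

theorem lin_injective : Function.Injective (fun f : U ⟶ V => f.lin) := fun _ _ h => hom_ext h

instance : AddCommGroup (U ⟶ V) :=
  lin_injective.addCommGroup _ rfl (fun _ _ => rfl) (fun _ => rfl) (fun _ _ => rfl)
    (fun _ _ => rfl) (fun _ _ => rfl)

instance : Module k (U ⟶ V) :=
  lin_injective.module k ⟨⟨fun f : U ⟶ V => f.lin, rfl⟩, fun _ _ => rfl⟩ (fun _ _ => rfl)

end HomModule

instance : Preadditive (SSpace k S) where
  add_comp _ _ _ f f' g := by ext x; simp
  comp_add _ _ _ f g g' := by ext x; simp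

instance : Linear k (SSpace k S) where
  smul_comp _ _ _ r f g := by ext x; simp
  comp_smul _ _ _ f r g := by ext x; simp

/-- The direct sum of two `S`-spaces. -/
def dsum (U V : SSpace k S) : SSpace k S where
  carrier := U.carrier × V.carrier
  sub s := (U.sub s).prod (V.sub s)
  mono _ _ h := Submodule.prod_mono (U.mono h) (V.mono h)

/-- `V` is full at `p` if `V(p) = V`. -/
def FullAt (p : S) (V : SSpace k S) : Prop := V.sub p = ⊤

/-- The `S`-spaces with no nonzero direct summand full at `p`. -/
def noFullSummand (k : Type u) [Field k] (p : S) : ObjectProperty (SSpace k S) := fun V =>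
  ∀ X Y : SSpace k S, Nonempty (V ≅ X.dsum Y) → X.FullAt p → Subsingleton X.carrier

/-- The subspace `𝔉(U, V)` of `Hom(U, V)` of all morphisms that factor through an `S`-space full
at `p`. -/
def factorsFull (p : S) (U V : SSpace k S) : Submodule k (U ⟶ V) where
  carrier := {f | ∃ (X : SSpace k S) (g : U ⟶ X) (h : X ⟶ V), X.FullAt p ∧ f = g ≫ h}
  zero_mem' := by
    refine ⟨⟨PUnit, fun _ => ⊤, fun _ _ _ => le_rfl⟩, 0, 0, rfl, ?_⟩
    simp
  add_mem' := by
    rintro _ _ ⟨X, g, h, hX, rfl⟩ ⟨X', g', h', hX', rfl⟩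
    refine ⟨X.dsum X', ⟨g.lin.prod g'.lin, fun s => ?_⟩, ⟨h.lin.coprod h'.lin, fun s => ?_⟩, ?_, ?_⟩
    · rintro _ ⟨x, hx, rfl⟩
      exact ⟨Hom.mem g hx, Hom.mem g' hx⟩
    · rintro _ ⟨x, hx, rfl⟩
      exact add_mem (Hom.mem h hx.1) (Hom.mem h' hx.2)
    · have h1 : X.sub p = ⊤ := hX
      have h2 : X'.sub p = ⊤ := hX'
      change (X.sub p).prod (X'.sub p) = ⊤
      rw [h1, h2, Submodule.prod_top]
    · refine hom_ext (LinearMap.ext fun x => ?_)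
      rfl
  smul_mem' := by
    rintro c _ ⟨X, g, h, hX, rfl⟩
    exact ⟨X, g, c • h, hX, by simp⟩

/-- The congruence on `S`-spaces defined by the two-sided ideal `𝔉`: two parallel morphisms are
related iff their difference factors through an `S`-space full at `p`. -/
def fullRel (k : Type u) [Field k] (p : S) : HomRel (SSpace k S) :=
  fun U V f g => f - g ∈ factorsFull p U V

instance (p : S) : Congruence (fullRel k p) where
  equivalence := {
    refl := fun f => by
      change f - f ∈ _
      rw [sub_self]
      exact zero_mem _
    symm := fun {f g} h => by
      change g - f ∈ _
      rw [← neg_sub]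
      exact neg_mem h
    trans := fun {f g h} h1 h2 => by
      change f - h ∈ _
      rw [← sub_add_sub_cancel f g h]
      exact add_mem h1 h2 }
  comp_left f g g' := by
    rintro ⟨X, a, b, hX, hab⟩
    exact ⟨X, f ≫ a, b, hX, by rw [← Preadditive.comp_sub, hab, Category.assoc]⟩
  comp_right g := by
    rintro ⟨X, a, b, hX, hab⟩
    exact ⟨X, a, b ≫ g, hX, by rw [← Preadditive.sub_comp, hab, Category.assoc]⟩

/-- The quotient category of `S`-spaces modulo the ideal `𝔉`: its objects are the `S`-spaces, and
its morphisms `U → V` are the elements of `Hom(U, V) / 𝔉(U, V)`. -/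
abbrev ModFull (k : Type u) [Field k] (p : S) := CategoryTheory.Quotient (fullRel k p)

variable {R : Type w} [PartialOrder R]

variable (k) in
/-- The restriction functor along the inclusion of a subposet. -/
def res (i : R ↪o S) : SSpace k S ⥤ SSpace k R where
  obj V := { carrier := V.carrier, sub := fun r => V.sub (i r), mono := V.mono.comp i.monotone }
  map f := ⟨f.lin, fun r => f.map_sub (i r)⟩

variable (k) in
/-- The coinduction functor along the inclusion of a subposet: `X(s)` is the intersection of all
`V(r)` with `s ≤ r`. -/
def coind (i : R ↪o S) : SSpace k R ⥤ SSpace k S where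
  obj V := {
    carrier := V.carrier
    sub := fun s => ⨅ (r : R) (_ : s ≤ i r), V.sub r
    mono := fun _ _ h => le_iInf₂ fun r hr => iInf₂_le r (h.trans hr) }
  map f := ⟨f.lin, fun s => by
    rintro _ ⟨x, hx, rfl⟩
    simp only [SetLike.mem_coe, Submodule.mem_iInf] at hx ⊢
    exact fun r hr => Hom.mem f (hx r hr)⟩

theorem coind_sub (i : R ↪o S) (V : SSpace k R) (r : R) :
    ((coind k i).obj V).sub (i r) = V.sub r :=
  le_antisymm (iInf₂_le (f := fun (r' : R) (_ : i r ≤ i r') => V.sub r') r le_rfl)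
    (le_iInf₂ (f := fun (r' : R) (_ : i r ≤ i r') => V.sub r')
      fun _ h => V.mono (i.le_iff_le.1 h))

variable (k) in
/-- The endofunctor `E_p`: it sends `V` to the space with ambient space `V / V(p)` and subspaces
`(V(s) + V(p)) / V(p)`. -/
def quotAt (p : S) : SSpace k S ⥤ SSpace k S where
  obj V := {
    carrier := V.carrier ⧸ V.sub p
    sub := fun s => (V.sub s ⊔ V.sub p).map (V.sub p).mkQ
    mono := fun _ _ h => Submodule.map_mono (sup_le_sup_right (V.mono h) _) }
  map {V W} f := ⟨(V.sub p).mapQ (W.sub p) f.lin (Submodule.map_le_iff_le_comap.1 (f.map_sub p)),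
    fun s => by
      rw [← Submodule.map_comp, Submodule.mapQ_mkQ, Submodule.map_comp, Submodule.map_sup]
      exact Submodule.map_mono (sup_le_sup (f.map_sub s) (f.map_sub p))⟩
  map_id V := by
    refine hom_ext (LinearMap.ext fun x => ?_)
    obtain ⟨x, rfl⟩ := Submodule.mkQ_surjective _ x
    rfl
  map_comp f g := by
    refine hom_ext (LinearMap.ext fun x => ?_)
    obtain ⟨x, rfl⟩ := Submodule.mkQ_surjective _ x
    rfl

variable (k) in
/-- The differentiation functor with respect to the principal filter `⟨p⟩`: coinduction from `S` to
`S_⟨p⟩`, followed by `E_p`, followed by restriction from `S_⟨p⟩` to `S_p`. -/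
def diff (p : S) : SSpace k S ⥤ SSpace k (Derived p) :=
  coind k (Enl.incl (Set.Ici p)) ⋙ quotAt k (Enl.incl (Set.Ici p) p) ⋙
    res k (OrderEmbedding.subtype _)

/-- The canonical identification, induced by the identity of `V`, of the ambient space of the
derivative of `V` with `V / V(p)`. -/
def ambient (p : S) (V : SSpace k S) :
    ((diff k p).obj V).carrier ≃ₗ[k] V.carrier ⧸ V.sub p :=
  Submodule.quotEquivOfEq _ _ (coind_sub (Enl.incl (Set.Ici p)) V p)

end SSpace

/-- A representation equivalence is a functor that is dense, full and reflects isomorphisms. -/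
structure IsRepresentationEquivalence {C : Type*} [Category C] {D : Type*} [Category D]
    (F : C ⥤ D) : Prop where
  dense : F.EssSurj
  full : F.Full
  reflectsIso : F.ReflectsIsomorphisms

end PosetDiff

/-! A morphism $f:U\to V$ is killed by $D$ exactly when $f(U)\subseteq V(p)$, and then it factors
through $V(p)$ with the induced subspaces, which is full at $p$. So the kernel of $D$ is $\mathfrak
F$ (`diff_map_eq_iff`), and (b) reduces to fullness and density.

Fullness (`diff_full`) is where the width bound does its work. A morphism $DU\to DV$ lifts at each
single vector $x\notin U(p)$: if $x$ lies in some $U(s)$ with $s\not\ge p$, the minimal such $s$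
form an antichain belonging to $S_p$, and this one element controls all the conditions on $x$. Width
at most 2 makes it possible to split off lines compatible with all these $U(s)$ at once, so
pointwise lifts assemble into a linear one (`exists_linear_lift`).

Density comes from an explicit integral: enough copies of $X$ to make the subspaces at $s\not\ge p$
coordinate sums, with $V(p)$ the kernel of the sum map to $X$.

For (a), Fitting's lemma makes every endomorphism with image in $V(p)$ nilpotent when $V$ has no
full summand. A lift of the inverse of $Df$ is then inverse to $f$ up to automorphisms $1+$
nilpotent. -/

namespace PosetDiff

/-! ### Linear lifts over posets of width at most two -/

section LinearLift

/-- In a poset of width at most two, let `U` be a monotone family of subspaces. Some nonzero vector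
lying in a member of the family has a linear functional equal to one on it and vanishing on all
members that do not contain it. -/
theorem exists_vector_functional {k : Type*} [Field k] {T : Type*} [PartialOrder T] [Finite T]
    (hT : ∀ a b c : T, a ≤ b ∨ b ≤ a ∨ a ≤ c ∨ c ≤ a ∨ b ≤ c ∨ c ≤ b)
    {M : Type*} [AddCommGroup M] [Module k M] (U : T → Submodule k M) (hU : Monotone U)
    [Nontrivial M] :
    ∃ (e : M) (φ : M →ₗ[k] k), φ e = 1 ∧ ∀ s, e ∉ U s → U s ≤ LinearMap.ker φ := by
  obtain ⟨e, he, hchain⟩ : ∃ e : M, e ≠ 0 ∧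
      Directed (· ≤ ·) (fun s : {s : T // e ∉ U s} => U s.1) := by
    by_cases h : ∃ s, U s ≠ ⊥
    · obtain ⟨s, hs⟩ := (Set.toFinite {s | U s ≠ ⊥}).exists_minimal h
      obtain ⟨e, hes, he⟩ := (Submodule.ne_bot_iff _).1 hs.prop
      refine ⟨e, he, fun a b => ?_⟩
      by_cases ha : U a.1 = ⊥
      · exact ⟨b, by simp [ha], le_rfl⟩
      by_cases hb : U b.1 = ⊥
      · exact ⟨a, le_rfl, by simp [hb]⟩
      have key : ∀ c : {s : T // e ∉ U s}, U c.1 ≠ ⊥ → ¬ s ≤ c.1 ∧ ¬ c.1 ≤ s := fun c hc =>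
        have h1 : ¬ s ≤ c.1 := fun h => c.2 (hU h hes)
        ⟨h1, fun h => h1 (hs.le_of_le hc h)⟩
      rcases hT s a.1 b.1 with h | h | h | h | h | h
      · exact absurd h (key a ha).1
      · exact absurd h (key a ha).2
      · exact absurd h (key b hb).1
      · exact absurd h (key b hb).2
      · exact ⟨b, hU h, le_rfl⟩
      · exact ⟨a, le_rfl, hU h⟩
    · push Not at h
      obtain ⟨e, he⟩ := exists_ne (0 : M)
      exact ⟨e, he, fun a b => ⟨a, le_rfl, by simp [h]⟩⟩
  -- By directedness the sum of the members avoiding `e` is their union (or zero), so a functional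
  -- can separate `e` from it.
  have hmem : e ∉ ⨆ s : {s : T // e ∉ U s}, U s.1 := by
    intro h
    rcases isEmpty_or_nonempty {s : T // e ∉ U s} with hN | hN
    · rw [iSup_of_empty] at h
      exact he h
    · obtain ⟨s, hs⟩ := (Submodule.mem_iSup_of_directed _ hchain).1 h
      exact s.2 hs
  obtain ⟨φ, hφ, hle⟩ := Submodule.exists_le_ker_of_notMem hmem
  refine ⟨e, (φ e)⁻¹ • φ, by simp [hφ], fun s hs x hx => ?_⟩
  have : φ x = 0 := hle (Submodule.mem_iSup_of_mem ⟨s, hs⟩ hx)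
  simp [this]

/-- Over a poset of width at most two, a linear map that lifts pointwise compatibly with monotone
families of subspaces has a compatible linear lift. -/
theorem exists_linear_lift {k : Type*} [Field k] {T : Type*} [PartialOrder T] [Finite T]
    (hT : ∀ a b c : T, a ≤ b ∨ b ≤ a ∨ a ≤ c ∨ c ≤ a ∨ b ≤ c ∨ c ≤ b)
    {N Y : Type*} [AddCommGroup N] [Module k N] [AddCommGroup Y] [Module k Y]
    (V : T → Submodule k N) (π : N →ₗ[k] Y)
    {M : Type*} [AddCommGroup M] [Module k M] [FiniteDimensional k M]
    (U : T → Submodule k M) (hU : Monotone U) (g : M →ₗ[k] Y)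
    (h : ∀ x, ∃ y, π y = g x ∧ ∀ s, x ∈ U s → y ∈ V s) :
    ∃ f : M →ₗ[k] N, π ∘ₗ f = g ∧ ∀ s, ∀ x ∈ U s, f x ∈ V s := by
  induction hn : Module.finrank k M using Nat.strong_induction_on generalizing M with
  | _ n ih =>
  rcases subsingleton_or_nontrivial M with hM | hM
  · refine ⟨0, LinearMap.ext fun x => ?_, fun s x _ => by simp⟩
    simp [Subsingleton.elim x 0]
  obtain ⟨e, φ, hφ, hker⟩ := exists_vector_functional hT U hU
  have he : ∀ x, x - φ x • e ∈ LinearMap.ker φ := fun x => by simp [hφ]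
  have hlt : Module.finrank k (LinearMap.ker φ) < n := by
    rw [← hn]
    apply Submodule.finrank_lt
    intro htop
    have : e ∈ LinearMap.ker φ := htop ▸ Submodule.mem_top
    simp [hφ] at this
  obtain ⟨f₀, hf₀, hf₀s⟩ := ih _ hlt (fun s => (U s).comap (LinearMap.ker φ).subtype)
    (fun _ _ hst => Submodule.comap_mono (hU hst)) (g ∘ₗ (LinearMap.ker φ).subtype)
    (fun x => h x.1) rfl
  obtain ⟨y, hy, hys⟩ := h e
  -- Here $M=\ker\varphi\oplus ke$: the induction hypothesis lifts the first summand and the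
  -- pointwise lift `y` of `e` handles the second.
  refine ⟨f₀ ∘ₗ (LinearMap.id - φ.smulRight e).codRestrict (LinearMap.ker φ) he +
    φ.smulRight y, LinearMap.ext fun x => ?_, fun s x hx => ?_⟩
  · have := LinearMap.congr_fun hf₀ ⟨x - φ x • e, he x⟩
    simp only [LinearMap.comp_apply, Submodule.subtype_apply, map_sub, map_smul] at this
    have h2 : (LinearMap.id - φ.smulRight e).codRestrict (LinearMap.ker φ) he x =
      ⟨x - φ x • e, he x⟩ := rfl
    simp [h2, this, hy]
  · have h2 : (LinearMap.id - φ.smulRight e).codRestrict (LinearMap.ker φ) he x =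
      ⟨x - φ x • e, he x⟩ := rfl
    simp only [LinearMap.add_apply, LinearMap.comp_apply, h2, LinearMap.smulRight_apply]
    -- The splitting respects every $U(s)$: either $e\in U(s)$ and the projection along $e$
    -- preserves $U(s)$, or $U(s)\subseteq\ker\varphi$ already.
    by_cases hes : e ∈ U s
    · exact add_mem (hf₀s s _ (sub_mem hx (Submodule.smul_mem _ _ hes)))
        (Submodule.smul_mem _ _ (hys s hes))
    · have h0 : φ x = 0 := hker s hes hx
      refine add_mem (hf₀s s _ ?_) (by simp [h0])
      simpa [h0] using hx

end LinearLift

/-! ### Width and the elements of the derived poset -/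

section Width

variable {S : Type v} [PartialOrder S]

theorem encard_le_width {T A : Set S} (hA : A ⊆ T) (hanti : IsAntichain (· ≤ ·) A) :
    A.encard ≤ width T :=
  le_iSup (fun A : {A : Set S // A ⊆ T ∧ IsAntichain (· ≤ ·) A} => A.1.encard) ⟨A, hA, hanti⟩

theorem exists_le_of_width_le_two {T : Set S} (hw : width T ≤ 2) (a b c : T) :
    a ≤ b ∨ b ≤ a ∨ a ≤ c ∨ c ≤ a ∨ b ≤ c ∨ c ≤ b := by
  by_contra! h
  obtain ⟨hab, hba, hac, hca, hbc, hcb⟩ := h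
  have hanti : IsAntichain (· ≤ ·) ({a.1, b.1, c.1} : Set S) := by
    rintro x (rfl | rfl | rfl) y (rfl | rfl | rfl) hne <;>
      first | exact absurd rfl hne | assumption
  have h3 : ({a.1, b.1, c.1} : Set S).encard = 3 := by
    rw [Set.encard_eq_three]
    exact ⟨a, b, c, fun h => hab (Subtype.ext h).le, fun h => hac (Subtype.ext h).le,
      fun h => hbc (Subtype.ext h).le, rfl⟩
  have := (encard_le_width (T := T) (by
    rintro x (rfl | rfl | rfl)
    exacts [a.2, b.2, c.2]) hanti).trans hw
  rw [h3] at this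
  exact absurd this (by decide)

theorem AHat.eq_single_or_pair {T : Set S} (hw : width T ≤ 2) (A : AHat S) (hA : A.carrier ⊆ T) :
    (∃ a, A.carrier = {a}) ∨ ∃ a b, a ≠ b ∧ A.carrier = {a, b} := by
  have hle := (encard_le_width hA A.antichain).trans hw
  have hfin : A.carrier.Finite := Set.finite_of_encard_le_coe (k := 2) hle
  have hpos := Set.encard_pos.2 A.nonempty
  rw [← hfin.cast_ncard_eq] at hle hpos
  have hle' : A.carrier.ncard ≤ 2 := by exact_mod_cast hle
  have hpos' : 0 < A.carrier.ncard := by exact_mod_cast hpos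
  obtain h | h : A.carrier.ncard = 1 ∨ A.carrier.ncard = 2 := by omega
  · exact Or.inl (Set.ncard_eq_one.1 h)
  · exact Or.inr (Set.ncard_eq_two.1 h)

/-- The filter $\langle p\rangle$ contributes only singletons; any other element is an antichain
outside it, hence of size one or two. Its members are not above $p$ by that choice and not below $p$
since the element itself is not. -/
theorem Derived.eq_single_or_meet {p : S} (hw : width (Set.Ici p : Set S)ᶜ ≤ 2) (t : Derived p) :
    (∃ (s : S) (hs : ¬ s ≤ p), t = Derived.single s hs) ∨
      ∃ (a b : S) (ha : a ∉ Set.Ici p ∪ Set.Iic p) (hb : b ∉ Set.Ici p ∪ Set.Iic p)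
        (hab : IsAntichain (· ≤ ·) ({p, a, b} : Set S)),
        a ≠ b ∧ t = Derived.meet a b ha hb hab := by
  obtain ⟨⟨A, hA⟩, ht⟩ := t
  have hnle : ∀ a ∈ A.carrier, ¬ a ≤ p := fun a ha hap => ht (by
    rintro b (rfl : b = p)
    exact ⟨a, ha, hap⟩)
  have hsingle : ∀ s, A.carrier = {s} → ∃ (s : S) (hs : ¬ s ≤ p),
      (⟨⟨A, hA⟩, ht⟩ : Derived p) = Derived.single s hs := fun s hs =>
    ⟨s, hnle s (by simp [hs]), Subtype.ext (Subtype.ext (AHat.ext hs))⟩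
  obtain ⟨r, -, hr⟩ | hA := id hA
  · exact Or.inl (hsingle r (congrArg AHat.carrier hr))
  rcases A.eq_single_or_pair hw hA with ⟨s, hs⟩ | ⟨a, b, hne, hab⟩
  · exact Or.inl (hsingle s hs)
  have ha : a ∈ A.carrier := by simp [hab]
  have hb : b ∈ A.carrier := by simp [hab]
  refine Or.inr ⟨a, b, fun h => h.elim (hA ha) (hnle a ha), fun h => h.elim (hA hb) (hnle b hb),
    ?_, hne, Subtype.ext (Subtype.ext (AHat.ext hab))⟩
  rw [IsAntichain, Set.pairwise_insert]
  refine ⟨?_, ?_⟩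
  · rw [← hab]
    exact A.antichain
  · rw [← hab]
    exact fun c hc _ => ⟨hA hc, hnle c hc⟩

instance [Finite S] : Finite (AHat S) :=
  Finite.of_injective AHat.carrier fun _ _ => AHat.ext

theorem Enl.le_incl_iff {R : Set S} {A : Enl R} {s : S} :
    A ≤ Enl.incl R s ↔ ∃ a ∈ A.1.carrier, a ≤ s :=
  ⟨fun h => h s rfl, fun h => by
    rintro _ rfl
    exact h⟩

end Width

end PosetDiff

namespace PosetDiff

namespace SSpace

variable {k : Type u} [Field k] {S : Type v} [PartialOrder S]

/-! ### Direct sum decompositions -/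

section Decomposition

/-- A linear equivalence of ambient spaces that matches the subspaces is an isomorphism. -/
def isoOfEquiv {U V : SSpace k S} (e : U.carrier ≃ₗ[k] V.carrier)
    (h : ∀ s x, x ∈ U.sub s ↔ e x ∈ V.sub s) : U ≅ V where
  hom := ⟨e.toLinearMap, fun s => by
    rintro _ ⟨x, hx, rfl⟩
    exact (h s x).1 hx⟩
  inv := ⟨e.symm.toLinearMap, fun s => by
    rintro _ ⟨x, hx, rfl⟩
    exact (h s _).2 (by simpa using hx)⟩
  hom_inv_id := hom_ext (LinearMap.ext fun x => e.symm_apply_apply x)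
  inv_hom_id := hom_ext (LinearMap.ext fun x => e.apply_symm_apply x)

/-- The `S`-space induced on a subspace of the ambient space. -/
def induced (V : SSpace k S) (P : Submodule k V.carrier) : SSpace k S where
  carrier := P
  sub s := (V.sub s).comap P.subtype
  mono _ _ h := Submodule.comap_mono (V.mono h)

theorem nonempty_iso_dsum_induced (V : SSpace k S) {P Q : Submodule k V.carrier} (h : IsCompl P Q)
    (hs : ∀ s, V.sub s ≤ V.sub s ⊓ P ⊔ V.sub s ⊓ Q) :
    Nonempty (V ≅ (V.induced P).dsum (V.induced Q)) := by
  refine ⟨(isoOfEquiv (U := (V.induced P).dsum (V.induced Q))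
    (Submodule.prodEquivOfIsCompl P Q h) fun s x => ⟨fun hx => ?_, fun hx => ?_⟩).symm⟩
  · exact add_mem hx.1 hx.2
  · obtain ⟨a, ⟨ha, haP⟩, b, ⟨hb, hbQ⟩, hab⟩ := Submodule.mem_sup.1 (hs s hx)
    have : x = ((⟨a, haP⟩, ⟨b, hbQ⟩) : P × Q) :=
      (Submodule.prodEquivOfIsCompl P Q h).injective hab.symm
    rw [this]
    exact ⟨ha, hb⟩

/-- The inclusion of the second summand. -/
def inr (U V : SSpace k S) : V ⟶ U.dsum V :=
  ⟨LinearMap.inr k U.carrier V.carrier, fun s => by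
    rintro _ ⟨x, hx, rfl⟩
    exact ⟨zero_mem _, hx⟩⟩

/-- The projection to the second summand. -/
def snd (U V : SSpace k S) : U.dsum V ⟶ V :=
  ⟨LinearMap.snd k U.carrier V.carrier, fun s => by
    rintro _ ⟨x, hx, rfl⟩
    exact hx.2⟩

end Decomposition

/-! ### The ideal of morphisms through full spaces, and Fitting's lemma -/

section Full

/-- The universal choice of full space is $V(p)$ with the induced subspaces. This turns the ideal
into a linear condition on the image. -/
theorem mem_factorsFull_iff {p : S} {U V : SSpace k S} (f : U ⟶ V) :
    f ∈ factorsFull p U V ↔ ∀ x, f.lin x ∈ V.sub p := by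
  constructor
  · rintro ⟨X, g, h, hX, rfl⟩ x
    have hX : X.sub p = ⊤ := hX
    exact Hom.mem h (hX ▸ Submodule.mem_top)
  · intro hf
    refine ⟨V.induced (V.sub p), ⟨f.lin.codRestrict (V.sub p) hf, fun s => ?_⟩,
      ⟨(V.sub p).subtype, fun s => ?_⟩, ?_, rfl⟩
    · rintro _ ⟨x, hx, rfl⟩
      exact Hom.mem f hx
    · rintro _ ⟨x, hx, rfl⟩
      exact hx
    · exact Submodule.comap_subtype_self _

theorem End.lin_pow {V : SSpace k S} (f : End V) (n : ℕ) :
    Hom.lin (f ^ n) = (Hom.lin f : Module.End k V.carrier) ^ n := by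
  induction n with
  | zero => rfl
  | succ n ih =>
    rw [pow_succ, pow_succ, ← ih]
    rfl

/-- If `V` has no nonzero direct summand full at `p`, every endomorphism of `V` with image in `V(p)`
is nilpotent, by Fitting's lemma. -/
theorem isNilpotent_of_noFullSummand [Finite S] {p : S} {V : SSpace k S}
    (hV : noFullSummand k p V) (f : End V) (hf : ∀ x, Hom.lin f x ∈ V.sub p) : IsNilpotent f := by
  let F : Module.End k V.carrier := Hom.lin f
  have hres : ∀ s, ∀ x ∈ V.sub s, F x ∈ V.sub s := fun s x hx => Hom.mem f hx
  -- As $S$ is finite, one exponent serves for $F$ and all its restrictions to the $V(s)$. The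
  -- Fitting decomposition of $V$ then induces that of each $V(s)$, so it splits $V$ as an
  -- $S$-space.
  have hev : ∀ᶠ n in Filter.atTop, 0 < n ∧ IsCompl (LinearMap.ker (F ^ n)) (LinearMap.range (F ^ n)) ∧
      ∀ s, IsCompl (LinearMap.ker ((F.restrict (hres s)) ^ n))
        (LinearMap.range ((F.restrict (hres s)) ^ n)) :=
    (Filter.eventually_gt_atTop 0).and (F.eventually_isCompl_ker_pow_range_pow.and
      (Filter.eventually_all.2 fun s => (F.restrict (hres s)).eventually_isCompl_ker_pow_range_pow))
  obtain ⟨n, hn, hc, hcs⟩ := hev.exists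
  have hrest : ∀ s (x : V.sub s), (((F.restrict (hres s)) ^ n) x : V.carrier) = (F ^ n) x := by
    intro s x
    rw [Module.End.pow_restrict n (hres s)]
    rfl
  have hiso := V.nonempty_iso_dsum_induced hc.symm fun s x hx => by
    obtain ⟨a, ha, b, ⟨c, hcb⟩, hab⟩ := Submodule.mem_sup.1
      ((hcs s).sup_eq_top ▸ Submodule.mem_top : (⟨x, hx⟩ : V.sub s) ∈ _)
    have hab' : (b : V.carrier) + a = x := by
      rw [add_comm]
      exact congrArg Subtype.val hab
    rw [← hab']
    refine Submodule.add_mem_sup ⟨b.2, ⟨c, ?_⟩⟩ ⟨a.2, ?_⟩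
    · rw [← hcb, hrest]
    · have h0 : ((F.restrict (hres s)) ^ n) a = 0 := ha
      change (F ^ n) a = 0
      rw [← hrest, h0]
      rfl
  have hfull : (V.induced (LinearMap.range (F ^ n))).FullAt p := by
    refine Submodule.comap_subtype_eq_top.2 ?_
    rintro _ ⟨x, rfl⟩
    -- Positivity of the exponent puts the range of $F^n$ inside that of $F$, hence inside $V(p)$.
    obtain ⟨m, rfl⟩ := Nat.exists_eq_succ_of_ne_zero hn.ne'
    rw [pow_succ']
    exact hf _
  have hsub : Subsingleton (LinearMap.range (F ^ n)) := hV _ _ hiso hfull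
  refine ⟨n, hom_ext ?_⟩
  rw [End.lin_pow]
  exact LinearMap.range_eq_bot.1 (Submodule.subsingleton_iff_eq_bot.1 hsub)

theorem isIso_id_add_of_noFullSummand [Finite S] {p : S} {V : SSpace k S}
    (hV : noFullSummand k p V) (f : V ⟶ V) (hf : ∀ x, f.lin x ∈ V.sub p) : IsIso (𝟙 V + f) :=
  (isUnit_iff_isIso (X := V) _).1
    (IsNilpotent.isUnit_one_add (isNilpotent_of_noFullSummand hV f hf))

end Full

end SSpace

end PosetDiff

/-! ### The derivative in terms of vectors of $V$ -/

namespace PosetDiff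

namespace SSpace

variable {k : Type u} [Field k] {S : Type v} [PartialOrder S] {p : S}

/-- The subspaces of the coinduction of `V` to the poset `S_⟨p⟩`, as subspaces of `V`. -/
def coindSub (V : SSpace k S) (t : Enl (Set.Ici p)) : Submodule k V.carrier :=
  ((coind k (Enl.incl (Set.Ici p))).obj V).sub t

theorem mem_coindSub (V : SSpace k S) (t : Enl (Set.Ici p)) (x : V.carrier) :
    x ∈ coindSub V t ↔ ∀ r, t ≤ Enl.incl _ r → x ∈ V.sub r := by
  change x ∈ (⨅ (r : S) (_ : t ≤ Enl.incl _ r), V.sub r) ↔ _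
  simp only [Submodule.mem_iInf]

theorem coindSub_incl (V : SSpace k S) (s : S) :
    coindSub V (Enl.incl (Set.Ici p) s) = V.sub s :=
  coind_sub _ V s

theorem coindSub_single (V : SSpace k S) {s : S} (hs : ¬ s ≤ p) :
    coindSub V (Derived.single s hs).1 = V.sub s :=
  coind_sub _ V s

/-- The quotient map from `V` to the ambient space of its derivative. -/
def toDiff (p : S) (V : SSpace k S) : V.carrier →ₗ[k] ((diff k p).obj V).carrier :=
  (coindSub V (Enl.incl (Set.Ici p) p)).mkQ

theorem toDiff_surjective (V : SSpace k S) : Function.Surjective (toDiff p V) :=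
  Submodule.mkQ_surjective _

theorem toDiff_eq_zero_iff (V : SSpace k S) (x : V.carrier) : toDiff p V x = 0 ↔ x ∈ V.sub p :=
  (Submodule.Quotient.mk_eq_zero (coindSub V (Enl.incl (Set.Ici p) p))).trans
    (by rw [coindSub_incl])

theorem toDiff_eq_iff (V : SSpace k S) (x y : V.carrier) :
    toDiff p V x = toDiff p V y ↔ x - y ∈ V.sub p := by
  rw [← toDiff_eq_zero_iff, map_sub, sub_eq_zero]

theorem diff_map_toDiff {U V : SSpace k S} (f : U ⟶ V) (x : U.carrier) :
    ((diff k p).map f).lin (toDiff p U x) = toDiff p V (f.lin x) := rfl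

theorem mem_diff_sub_iff (V : SSpace k S) (t : Derived p) (y : ((diff k p).obj V).carrier) :
    y ∈ ((diff k p).obj V).sub t ↔ ∃ x ∈ coindSub V t.1, toDiff p V x = y := by
  constructor
  · rintro ⟨z, hz, rfl⟩
    obtain ⟨a, ha, b, hb, rfl⟩ := Submodule.mem_sup.1 hz
    have key : ∀ a b : V.carrier, b ∈ V.sub p → toDiff p V a = toDiff p V (a + b) :=
      fun a b hb => by rw [map_add, (toDiff_eq_zero_iff V b).2 hb, add_zero]
    exact ⟨a, ha, key a b ((coindSub_incl V p).le hb)⟩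
  · rintro ⟨x, hx, rfl⟩
    exact ⟨x, Submodule.mem_sup_left hx, rfl⟩

theorem map_ambient_diff_sub (V : SSpace k S) (t : Derived p) :
    (((diff k p).obj V).sub t).map (ambient p V).toLinearMap =
      (coindSub V t.1 ⊔ V.sub p).map (V.sub p).mkQ := by
  have hp : (V.sub p).map (V.sub p).mkQ = ⊥ := by simp
  rw [Submodule.map_sup, hp, sup_bot_eq]
  ext y
  constructor
  · rintro ⟨z, hz, rfl⟩
    obtain ⟨x, hx, rfl⟩ := (mem_diff_sub_iff V t z).1 hz
    exact ⟨x, hx, rfl⟩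
  · rintro ⟨x, hx, rfl⟩
    exact ⟨toDiff p V x, (mem_diff_sub_iff V t _).2 ⟨x, hx, rfl⟩, rfl⟩

theorem coindSub_meet (V : SSpace k S) (a b : S) (ha : a ∉ Set.Ici p ∪ Set.Iic p)
    (hb : b ∉ Set.Ici p ∪ Set.Iic p) (hab : IsAntichain (· ≤ ·) ({p, a, b} : Set S)) :
    coindSub V (Derived.meet a b ha hb hab).1 = V.sub a ⊓ V.sub b := by
  ext x
  rw [mem_coindSub]
  constructor
  · exact fun h => ⟨h a (Enl.le_incl_iff.2 ⟨a, Or.inl rfl, le_rfl⟩),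
      h b (Enl.le_incl_iff.2 ⟨b, Or.inr rfl, le_rfl⟩)⟩
  · rintro ⟨h1, h2⟩ r hr
    obtain ⟨c, rfl | rfl, hc⟩ := Enl.le_incl_iff.1 hr
    exacts [V.mono hc h1, V.mono hc h2]

/-- One direction makes $D$ descend to the quotient by $\mathfrak F$, the other makes the induced
functor faithful. -/
theorem diff_map_eq_iff {U V : SSpace k S} (f g : U ⟶ V) :
    (diff k p).map f = (diff k p).map g ↔ fullRel k p f g := by
  change _ ↔ f - g ∈ factorsFull p U V
  rw [mem_factorsFull_iff]
  constructor
  · intro h x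
    rw [sub_lin, LinearMap.sub_apply, ← toDiff_eq_iff, ← diff_map_toDiff, h, diff_map_toDiff]
  · intro h
    refine hom_ext (LinearMap.ext fun y => ?_)
    obtain ⟨x, rfl⟩ := toDiff_surjective U y
    rw [diff_map_toDiff, diff_map_toDiff, toDiff_eq_iff]
    exact h x

/-- The minimal elements of the set of all `s` outside `⟨p⟩` with `x ∈ V(s)` form an element of
the derived poset, provided that this set is nonempty and `x ∉ V(p)`. -/
theorem exists_derived_of_mem [Finite S] (V : SSpace k S) {x : V.carrier} (hx : x ∉ V.sub p)
    (hne : ∃ s, ¬ p ≤ s ∧ x ∈ V.sub s) :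
    ∃ t : Derived p, x ∈ coindSub V t.1 ∧
      ∀ s, ¬ p ≤ s → x ∈ V.sub s → t.1 ≤ Enl.incl _ s := by
  let F : Set S := {s | ¬ p ≤ s ∧ x ∈ V.sub s}
  have hmin : ∀ s ∈ F, ∃ a ≤ s, Minimal (· ∈ F) a := fun s hs =>
    (Set.toFinite F).exists_le_minimal hs
  let A : AHat S := ⟨{a | Minimal (· ∈ F) a},
    hne.elim fun s hs => (hmin s hs).elim fun a ha => ⟨a, ha.2⟩,
    fun a ha b hb hne hab => hne (hb.eq_of_le ha.prop hab)⟩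
  refine ⟨⟨⟨A, Or.inr fun a ha => ha.prop.1⟩, fun h => ?_⟩, ?_, fun s h1 h2 => ?_⟩
  -- If the antichain were below $p$, some member $a\le p$ would give $x\in V(a)\subseteq V(p)$.
  · obtain ⟨a, ha, hap⟩ := Enl.le_incl_iff.1 h
    exact hx (V.mono hap ha.prop.2)
  · rw [mem_coindSub]
    intro r hr
    obtain ⟨a, ha, har⟩ := Enl.le_incl_iff.1 hr
    exact V.mono har ha.prop.2
  · obtain ⟨a, has, ha⟩ := hmin s ⟨h1, h2⟩
    exact Enl.le_incl_iff.2 ⟨a, ha, has⟩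

/-- The linear lift is built over $S\setminus\langle p\rangle$ only. For $s\ge p$ the condition is
automatic: since $V(p)\subseteq V(s)$, membership in $V(s)$ can be tested modulo $V(p)$. -/
theorem diff_full [Finite S] (hw : width (Set.Ici p : Set S)ᶜ ≤ 2) : (diff k p).Full where
  map_surjective {U V} g := by
    have hlift : ∀ x : U.carrier, ∃ y : V.carrier, toDiff p V y = g.lin (toDiff p U x) ∧
        ∀ s : ((Set.Ici p)ᶜ : Set S), x ∈ U.sub s.1 → y ∈ V.sub s.1 := by
      intro x
      by_cases hx : x ∈ U.sub p
      · exact ⟨0, by rw [(toDiff_eq_zero_iff U x).2 hx, map_zero, map_zero], fun _ _ => zero_mem _⟩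
      by_cases hne : ∃ s, ¬ p ≤ s ∧ x ∈ U.sub s
      -- Lifting `g` at the single index `t` suffices, because `t` lies below every `s` outside
      -- $\langle p\rangle$ with $x\in U(s)$.
      · obtain ⟨t, hxt, ht⟩ := U.exists_derived_of_mem hx hne
        obtain ⟨y, hy, hyx⟩ := (mem_diff_sub_iff V t _).1
          (Hom.mem g ((mem_diff_sub_iff U t _).2 ⟨x, hxt, rfl⟩))
        exact ⟨y, hyx, fun s hs => (mem_coindSub V _ _).1 hy s.1 (ht s.1 s.2 hs)⟩
      · obtain ⟨y, hy⟩ := toDiff_surjective V (g.lin (toDiff p U x))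
        exact ⟨y, hy, fun s hs => absurd ⟨s.1, s.2, hs⟩ hne⟩
    obtain ⟨f, hf, hfs⟩ := exists_linear_lift (exists_le_of_width_le_two hw)
      (fun s => V.sub s.1) (toDiff p V) (fun s => U.sub s.1) (fun _ _ h => U.mono h)
      (g.lin ∘ₗ toDiff p U) hlift
    have hf : ∀ x, toDiff p V (f x) = g.lin (toDiff p U x) := LinearMap.congr_fun hf
    have hfp : ∀ x ∈ U.sub p, f x ∈ V.sub p := fun x hx => by
      rw [← toDiff_eq_zero_iff, hf, (toDiff_eq_zero_iff U x).2 hx, map_zero]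
    refine ⟨⟨f, fun s => ?_⟩, hom_ext (LinearMap.ext fun y => ?_)⟩
    · rintro _ ⟨x, hx, rfl⟩
      by_cases hps : p ≤ s
      · by_cases hsp : s ≤ p
        · obtain rfl := le_antisymm hps hsp
          exact hfp x hx
        · obtain ⟨y, hy, hyx⟩ := (mem_diff_sub_iff V (Derived.single s hsp) _).1
            (Hom.mem g ((mem_diff_sub_iff U (Derived.single s hsp) _).2
              ⟨x, (coindSub_single U hsp).ge hx, rfl⟩))
          rw [coindSub_single] at hy
          rw [← hf, toDiff_eq_iff] at hyx
          rw [← sub_sub_cancel y (f x)]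
          exact sub_mem hy (V.mono hps hyx)
      · exact hfs ⟨s, hps⟩ x hx
    · obtain ⟨x, rfl⟩ := toDiff_surjective U y
      exact hf x

/-- Removing direct summands full at `p` does not change the derivative. -/
theorem exists_noFullSummand_diff_iso (p : S) (V : SSpace k S) :
    ∃ W, noFullSummand k p W ∧ Nonempty ((diff k p).obj W ≅ (diff k p).obj V) := by
  induction hn : Module.finrank k V.carrier using Nat.strong_induction_on generalizing V with
  | _ n ih =>
  by_cases hV : noFullSummand k p V
  · exact ⟨V, hV, ⟨Iso.refl _⟩⟩
  simp only [noFullSummand] at hV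
  push Not at hV
  obtain ⟨X, Y, ⟨e⟩, hX, hnt⟩ := hV
  have hle : Module.finrank k X.carrier + Module.finrank k Y.carrier = n := by
    rw [← hn, ← Module.finrank_prod]
    exact LinearEquiv.finrank_eq (LinearEquiv.ofLinearMap e.inv.lin e.hom.lin
      (congrArg Hom.lin e.hom_inv_id) (congrArg Hom.lin e.inv_hom_id))
  have hpos : 0 < Module.finrank k X.carrier := Module.finrank_pos
  obtain ⟨W, hW, ⟨i⟩⟩ := ih _ (by omega) Y rfl
  refine ⟨W, hW, ⟨i ≪≫ (?_ : (diff k p).obj Y ≅ (diff k p).obj (X.dsum Y)) ≪≫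
    (diff k p).mapIso e.symm⟩⟩
  refine ⟨(diff k p).map (inr X Y), (diff k p).map (snd X Y), ?_, ?_⟩
  · rw [← Functor.map_comp, ← (diff k p).map_id]
    rfl
  -- The difference of the two maps is, up to sign, the projection onto the summand $X$, whose image
  -- lies in $X(p)=X$.
  · rw [← Functor.map_comp, ← (diff k p).map_id, diff_map_eq_iff]
    refine (mem_factorsFull_iff _).2 fun x => ⟨?_, ?_⟩
    · have hX : X.sub p = ⊤ := hX
      exact hX ▸ Submodule.mem_top
    · have : ((snd X Y ≫ inr X Y - 𝟙 (X.dsum Y)).lin x).2 = x.2 - x.2 := rfl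
      rw [this, sub_self]
      exact zero_mem _

/-! ### Density: integrating a space over the derived poset -/

section Dense

/-- An integral of a space `X` over the derived poset: the sum of copies of `X`, one for each
element of the derived poset and one more, with the sum map `totalSum` to `X`. -/
abbrev IntegralCarrier (X : SSpace k (Derived p)) : Type u :=
  (Fin (Nat.card (Derived p)) → X.carrier) × X.carrier

/-- The sum map from an integral of `X` to `X`. -/
noncomputable def totalSum (X : SSpace k (Derived p)) : IntegralCarrier X →ₗ[k] X.carrier :=
  (∑ i, LinearMap.proj i) ∘ₗ LinearMap.fst k _ _ + LinearMap.snd k _ _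

theorem totalSum_apply (X : SSpace k (Derived p)) (v : IntegralCarrier X) :
    totalSum X v = ∑ i, v.1 i + v.2 := by
  simp [totalSum]

variable [Finite S]

/-- The subspace of vectors supported on the components indexed by `t ∈ I`, with the component
indexed by `t` lying in `X(t)`. -/
def supportedOn (X : SSpace k (Derived p)) (I : Set (Derived p)) :
    Submodule k (IntegralCarrier X) where
  carrier := {v | v.2 = 0 ∧ ∀ i, v.1 i ∈ X.sub ((Finite.equivFin _).symm i) ∧
    ((Finite.equivFin _).symm i ∉ I → v.1 i = 0)}
  zero_mem' := ⟨rfl, fun _ => ⟨zero_mem _, fun _ => rfl⟩⟩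
  add_mem' {v w} hv hw := ⟨by simp [hv.1, hw.1], fun i => ⟨add_mem (hv.2 i).1 (hw.2 i).1,
    fun h => by simp [(hv.2 i).2 h, (hw.2 i).2 h]⟩⟩
  smul_mem' c v hv := ⟨by simp [hv.1], fun i => ⟨Submodule.smul_mem _ c (hv.2 i).1,
    fun h => by simp [(hv.2 i).2 h]⟩⟩

theorem supportedOn_mono (X : SSpace k (Derived p)) : Monotone (supportedOn X) :=
  fun _ _ h _ hv => ⟨hv.1, fun i => ⟨(hv.2 i).1, fun hi => (hv.2 i).2 fun h' => hi (h h')⟩⟩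

theorem totalSum_mem (X : SSpace k (Derived p)) {I : Set (Derived p)} {P : Submodule k X.carrier}
    (hP : ∀ t ∈ I, X.sub t ≤ P) {v : IntegralCarrier X} (hv : v ∈ supportedOn X I) :
    totalSum X v ∈ P := by
  rw [totalSum_apply, hv.1, add_zero]
  refine sum_mem fun i _ => ?_
  by_cases hi : (Finite.equivFin _).symm i ∈ I
  · exact hP _ hi (hv.2 i).1
  · rw [(hv.2 i).2 hi]
    exact zero_mem _

theorem exists_supportedOn (X : SSpace k (Derived p)) {I : Set (Derived p)} {t : Derived p}
    (ht : t ∈ I) {x : X.carrier} (hx : x ∈ X.sub t) :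
    ∃ v ∈ supportedOn X I, totalSum X v = x := by
  refine ⟨(Pi.single (Finite.equivFin _ t) x, 0), ⟨rfl, fun i => ?_⟩, ?_⟩
  · obtain ⟨t', rfl⟩ := (Finite.equivFin (Derived p)).surjective i
    rcases eq_or_ne t' t with rfl | hne
    · simp [hx, ht]
    · simp [Pi.single_eq_of_ne ((Finite.equivFin _).injective.ne hne)]
  · simp [totalSum_apply]

open Classical in
/-- The subspace at `s` of an integral of `X`. -/
noncomputable def integralSub (X : SSpace k (Derived p)) (s : S) :
    Submodule k (IntegralCarrier X) :=
  if p ≤ s then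
    if hs : s ≤ p then LinearMap.ker (totalSum X)
    else (X.sub (Derived.single s hs)).comap (totalSum X)
  else supportedOn X {t | t.1 ≤ Enl.incl _ s}

theorem integralSub_self (X : SSpace k (Derived p)) :
    integralSub X p = LinearMap.ker (totalSum X) := by
  simp [integralSub]

theorem integralSub_of_lt (X : SSpace k (Derived p)) {s : S} (h : p ≤ s) (hs : ¬ s ≤ p) :
    integralSub X s = (X.sub (Derived.single s hs)).comap (totalSum X) := by
  simp [integralSub, h, hs]

theorem integralSub_of_not_le (X : SSpace k (Derived p)) {s : S} (h : ¬ p ≤ s) :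
    integralSub X s = supportedOn X {t | t.1 ≤ Enl.incl _ s} := by
  simp [integralSub, h]

/-- The inclusions that cross into $\langle p\rangle$ hold because a vector supported on the $t\le
s$ has its sum in every $X(s')$ with $s'\ge s$, $s'>p$. -/
theorem integralSub_mono (X : SSpace k (Derived p)) : Monotone (integralSub X) := by
  intro s t hst
  by_cases hs : p ≤ s
  · have ht := hs.trans hst
    by_cases htp : t ≤ p
    · obtain rfl := le_antisymm ht htp
      rw [le_antisymm hst hs]
    rw [integralSub_of_lt X ht htp]
    by_cases hsp : s ≤ p
    · obtain rfl := le_antisymm hs hsp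
      rw [integralSub_self]
      intro v hv
      have hv : totalSum X v = 0 := hv
      simp [hv]
    · rw [integralSub_of_lt X hs hsp]
      exact Submodule.comap_mono (X.mono ((Enl.incl _).monotone hst))
  rw [integralSub_of_not_le X hs]
  by_cases ht : p ≤ t
  · by_cases htp : t ≤ p
    · obtain rfl := le_antisymm ht htp
      rw [integralSub_self]
      -- For $s\le p$ no element of $S_p$ lies below $s$, so the support is empty and the sum
      -- vanishes.
      exact fun v hv => (Submodule.mem_bot k).1
        (totalSum_mem X (fun r hr => absurd (hr.trans ((Enl.incl _).monotone hst)) r.2) hv)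
    · rw [integralSub_of_lt X ht htp]
      exact fun v hv => totalSum_mem X
        (fun r hr => X.mono (show r.1 ≤ Enl.incl _ t from hr.trans ((Enl.incl _).monotone hst))) hv
  · rw [integralSub_of_not_le X ht]
    exact supportedOn_mono X fun r hr => le_trans hr ((Enl.incl _).monotone hst)

/-- An `S`-space whose derivative is isomorphic to `X`. -/
noncomputable def integral (X : SSpace k (Derived p)) : SSpace k S where
  carrier := IntegralCarrier X
  sub := integralSub X
  mono := integralSub_mono X

/-- For an antichain $A$ outside $\langle p\rangle$, an index $t'$ is below $A$ iff it is below
every $a\in A$. So intersecting the coordinate sums over $A$ leaves the components with $t'\le A$,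
and these add up to vectors of $X(A)$. -/
theorem exists_mem_coind_integral_iff (X : SSpace k (Derived p)) (t : Derived p) (x : X.carrier) :
    (∃ v ∈ coindSub (integral X) t.1, totalSum X v = x) ↔
      x ∈ X.sub t := by
  constructor
  · rintro ⟨v, hv, rfl⟩
    rw [mem_coindSub] at hv
    have hsingle : ∀ s (hs : ¬ s ≤ p), p ≤ s → t = Derived.single s hs →
        totalSum X v ∈ X.sub t := by
      rintro s hs hps rfl
      have := hv s le_rfl
      change v ∈ integralSub X s at this
      rwa [integralSub_of_lt X hps hs] at this
    obtain ⟨r, hr, h⟩ | h := t.1.2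
    · have h' : t.1 = Enl.incl _ r := Subtype.ext h
      have hrp : ¬ r ≤ p := fun hrp => t.2 (h' ▸ (Enl.incl _).monotone hrp)
      exact hsingle r hrp hr (Subtype.ext h')
    · have hva : ∀ a ∈ t.1.1.carrier,
          v ∈ supportedOn X {t' : Derived p | t'.1 ≤ Enl.incl _ a} := fun a ha => by
        have := hv a (Enl.le_incl_iff.2 ⟨a, ha, le_rfl⟩)
        change v ∈ integralSub X a at this
        rwa [integralSub_of_not_le X (h ha)] at this
      obtain ⟨a₀, ha₀⟩ := t.1.1.nonempty
      refine totalSum_mem X (I := Set.Iic t) (fun t' ht' => X.mono ht')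
        ⟨(hva a₀ ha₀).1, fun i => ⟨((hva a₀ ha₀).2 i).1, fun hi => ?_⟩⟩
      by_contra hne
      refine hi fun a ha => Enl.le_incl_iff.1 ?_
      by_contra hle
      exact hne (((hva a ha).2 i).2 hle)
  · intro hx
    obtain ⟨r, hr, h⟩ | h := t.1.2
    · have h' : t.1 = Enl.incl _ r := Subtype.ext h
      have hrp : ¬ r ≤ p := fun hrp => t.2 (h' ▸ (Enl.incl _).monotone hrp)
      obtain rfl : t = Derived.single r hrp := Subtype.ext h'
      -- Above $p$ the subspace is a full preimage under the sum map, so the extra copy of $X$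
      -- supplies a preimage.
      refine ⟨(0, x), (coindSub_single (integral X) hrp).ge ?_,
        by simp [totalSum_apply]⟩
      change _ ∈ integralSub X r
      rw [integralSub_of_lt X hr hrp]
      simpa [totalSum_apply] using hx
    · obtain ⟨v, hv, hvx⟩ := exists_supportedOn X (I := {t}) rfl hx
      refine ⟨v, (mem_coindSub _ _ _).2 fun r hr => ?_, hvx⟩
      change v ∈ integralSub X r
      by_cases hpr : p ≤ r
      · by_cases hrp : r ≤ p
        · exact absurd (hr.trans ((Enl.incl _).monotone hrp)) t.2
        · rw [integralSub_of_lt X hpr hrp]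
          change totalSum X v ∈ X.sub _
          rw [hvx]
          exact X.mono (show t ≤ Derived.single r hrp from hr) hx
      · rw [integralSub_of_not_le X hpr]
        exact supportedOn_mono X (by simpa using hr) hv

theorem nonempty_diff_integral_iso (X : SSpace k (Derived p)) :
    Nonempty ((diff k p).obj (integral X) ≅ X) := by
  have hp : (integral X).sub p = LinearMap.ker (totalSum X) := integralSub_self X
  have hsurj : Function.Surjective (totalSum X) := fun x => ⟨(0, x), by simp [totalSum_apply]⟩
  let π : (integral X).carrier →ₗ[k] X.carrier := totalSum X
  let e := ambient p (integral X) ≪≫ₗ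
    (Submodule.quotEquivOfEq _ (LinearMap.ker π) hp ≪≫ₗ π.quotKerEquivOfSurjective hsurj)
  have he : ∀ v, e (toDiff p (integral X) v) = π v := fun v => rfl
  refine ⟨isoOfEquiv e fun t y => ?_⟩
  rw [mem_diff_sub_iff, ← exists_mem_coind_integral_iff]
  refine exists_congr fun v => and_congr_right fun _ => ?_
  change _ ↔ π v = _
  rw [← he, e.injective.eq_iff]

theorem diff_essSurj (p : S) : (diff k p).EssSurj where
  mem_essImage X := (nonempty_diff_integral_iso X).elim fun e => ⟨integral X, ⟨e⟩⟩

theorem noFullSummand_diff_essSurj (p : S) : ((noFullSummand k p).ι ⋙ diff k p).EssSurj where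
  mem_essImage X := by
    obtain ⟨e⟩ := nonempty_diff_integral_iso X
    obtain ⟨W, hW, ⟨i⟩⟩ := exists_noFullSummand_diff_iso p (integral X)
    exact ⟨⟨W, hW⟩, ⟨i ≪≫ e⟩⟩

end Dense

/-! ### Reflection of isomorphisms -/

theorem isIso_comp_of_diff_map_comp_eq_id [Finite S] {U V : SSpace k S} (hU : noFullSummand k p U)
    (f : U ⟶ V) (g : V ⟶ U) (h : (diff k p).map f ≫ (diff k p).map g = 𝟙 _) : IsIso (f ≫ g) := by
  rw [← Functor.map_comp, ← (diff k p).map_id, diff_map_eq_iff] at h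
  have := isIso_id_add_of_noFullSummand hU (f ≫ g - 𝟙 U) ((mem_factorsFull_iff _).1 h)
  rwa [add_sub_cancel] at this

/-- Fullness lifts the inverse of $Df$ to some $g$. Both composites of $f$ and $g$ are the identity
plus a nilpotent, so $f$ is split on both sides. -/
theorem isIso_of_isIso_diff_map [Finite S] (hw : width (Set.Ici p : Set S)ᶜ ≤ 2)
    {U V : SSpace k S} (hU : noFullSummand k p U) (hV : noFullSummand k p V) (f : U ⟶ V)
    [IsIso ((diff k p).map f)] : IsIso f := by
  have := diff_full (k := k) hw
  obtain ⟨g, hg⟩ := (diff k p).map_surjective (inv ((diff k p).map f))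
  have h1 : IsIso (f ≫ g) := isIso_comp_of_diff_map_comp_eq_id hU f g (by simp [hg])
  have h2 : IsIso (g ≫ f) := isIso_comp_of_diff_map_comp_eq_id hV g f (by simp [hg])
  have : IsSplitMono f := ⟨⟨⟨g ≫ inv (f ≫ g), by rw [← Category.assoc, IsIso.hom_inv_id]⟩⟩⟩
  have : IsSplitEpi f := ⟨⟨⟨inv (g ≫ f) ≫ g, by rw [Category.assoc, IsIso.inv_hom_id]⟩⟩⟩
  exact isIso_of_mono_of_isSplitEpi f

end SSpace

end PosetDiff

/-! ### The theorem -/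

theorem theorem5p10 {k : Type u} [Field k] {S : Type v} [PartialOrder S] [Finite S] (p : S)
    (hw : PosetDiff.width (Set.Ici p : Set S)ᶜ ≤ 2) :
    -- (a)
    PosetDiff.IsRepresentationEquivalence
      ((PosetDiff.SSpace.noFullSummand k p).ι ⋙ PosetDiff.SSpace.diff k p) ∧
    -- (b)
    (∃ H : ∀ (U V : PosetDiff.SSpace k S) (f g : U ⟶ V), PosetDiff.SSpace.fullRel k p f g →
        (PosetDiff.SSpace.diff k p).map f = (PosetDiff.SSpace.diff k p).map g,
      (CategoryTheory.Quotient.lift (PosetDiff.SSpace.fullRel k p)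
        (PosetDiff.SSpace.diff k p) H).IsEquivalence) ∧
    -- (c), on objects
    (∀ t : PosetDiff.Derived p,
      (∃ (s : S) (hs : ¬ s ≤ p), t = PosetDiff.Derived.single s hs) ∨
      (∃ (a b : S) (ha : a ∉ Set.Ici p ∪ Set.Iic p) (hb : b ∉ Set.Ici p ∪ Set.Iic p)
        (hab : IsAntichain (· ≤ ·) ({p, a, b} : Set S)),
        a ≠ b ∧ t = PosetDiff.Derived.meet a b ha hb hab)) ∧
    (∀ V : PosetDiff.SSpace k S,
      (∀ (s : S) (hs : ¬ s ≤ p),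
        (((PosetDiff.SSpace.diff k p).obj V).sub (PosetDiff.Derived.single s hs)).map
            (PosetDiff.SSpace.ambient p V).toLinearMap =
          (V.sub s ⊔ V.sub p).map (V.sub p).mkQ) ∧
      (∀ (a b : S) (ha : a ∉ Set.Ici p ∪ Set.Iic p) (hb : b ∉ Set.Ici p ∪ Set.Iic p)
        (hab : IsAntichain (· ≤ ·) ({p, a, b} : Set S)),
        (((PosetDiff.SSpace.diff k p).obj V).sub (PosetDiff.Derived.meet a b ha hb hab)).map
            (PosetDiff.SSpace.ambient p V).toLinearMap =
          (V.sub a ⊓ V.sub b ⊔ V.sub p).map (V.sub p).mkQ)) ∧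
    -- (c), on morphisms
    (∀ (U V : PosetDiff.SSpace k S) (f : U ⟶ V) (x : U.carrier),
      PosetDiff.SSpace.ambient p V (((PosetDiff.SSpace.diff k p).map f).lin
          ((PosetDiff.SSpace.ambient p U).symm ((U.sub p).mkQ x))) =
        (V.sub p).mkQ (f.lin x)) := by
  open PosetDiff PosetDiff.SSpace in
  have hfull := diff_full (k := k) hw
  have hess := diff_essSurj (k := k) p
  refine ⟨⟨noFullSummand_diff_essSurj p, inferInstance, ⟨fun f hf => ?_⟩⟩,
    ⟨fun U V f g => (diff_map_eq_iff f g).2, ?_⟩, Derived.eq_single_or_meet hw,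
    fun V => ⟨fun s hs => ?_, fun a b ha hb hab => ?_⟩, fun U V f x => rfl⟩
  · have : IsIso ((diff k p).map f.hom) := hf
    have : IsIso ((noFullSummand k p).ι.map f) :=
      isIso_of_isIso_diff_map hw (ObjectProperty.FullSubcategory.property _)
        (ObjectProperty.FullSubcategory.property _) f.hom
    exact (noFullSummand k p).fullyFaithfulι.isIso_of_isIso_map f
  · exact {
      faithful := ⟨fun {U V} f g h => by
        obtain ⟨f, rfl⟩ := (CategoryTheory.Quotient.functor _).map_surjective f
        obtain ⟨g, rfl⟩ := (CategoryTheory.Quotient.functor _).map_surjective g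
        exact CategoryTheory.Quotient.sound _ ((diff_map_eq_iff f g).1 h)⟩
      full := ⟨fun {U V} g => by
        obtain ⟨f, hf⟩ := (diff k p).map_surjective g
        exact ⟨(CategoryTheory.Quotient.functor _).map f, hf⟩⟩
      essSurj := ⟨fun X => by
        obtain ⟨V, ⟨e⟩⟩ := hess.mem_essImage X
        exact ⟨(CategoryTheory.Quotient.functor _).obj V, ⟨e⟩⟩⟩ }
  · rw [map_ambient_diff_sub]
    exact congrArg (fun P => (P ⊔ V.sub p).map (V.sub p).mkQ) (coindSub_single V hs)
  · rw [map_ambient_diff_sub, coindSub_meet]
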